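/- All spaces are separable and metrizable, and $\dim$ denotes topological dimension (equivalently, small inductive dimension). A space is called zero-dimensional, written $\dim = 0$, if it has a basis of clopen sets; in particular we put $\dim(\varnothing)=0$. A space $Y$ is *zero-dimensional at* $y\in Y$ if every neighbourhood of $y$ contains a clopen neighbourhood of $y$, and it is *$1$-dimensional at* $y$ if it is not zero-dimensional at $y$ but every neighbourhood of $y$ contains an open neighbourhood of $y$ whose boundary is zero-dimensional. The *dimensional kernel* of $Y$ is $\Lambda(Y)=\{y\in Y : Y \text{ is } 1\text{-dimensional at } y\}$, and $Y$ is *weakly $1$-dimensional* if $\dim(Y)=1$ but $\dim(\Lambda(Y))=0$. The *Cantor fan* is the cone over the Cantor set $C$; we realize it in the plane as the union of the line segments from $(0,0)$ to the points $(c,1)$, $c\in C$. A *smooth fan* is a compact connected subset of the Cantor fan. The set $E(X)$ of endpoints of a smooth fan $X$ consists of all $x\in X$ such that $x$ is an endpoint of every arc in $X$ that contains $x$. **Corollary 3.** If $X$ is a smooth fan, then $\dim(\Lambda(Y))=\dim(Y)$ for every subspace $Y$ of $E(X)$. Thus $E(X)$ does not contain a weakly $1$-dimensional space. -/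

import Mathlib

open Set Topology

noncomputable section

namespace SmoothFan

/-- The dimension of a space, with values in `ℕ∞`: the small inductive dimension, with the
convention that the empty space, which trivially has a basis of clopen sets, has dimension `0`. -/
def dim (X : Type*) [TopologicalSpace X] : ℕ∞ :=
  (smallInductiveDimension X).unbotD 0

/-- `X` is zero-dimensional at `x`: every neighbourhood of `x` contains a clopen neighbourhood
of `x`. -/
def ZeroDimensionalAt {X : Type*} [TopologicalSpace X] (x : X) : Prop :=
  ∀ U ∈ 𝓝 x, ∃ V : Set X, IsClopen V ∧ x ∈ V ∧ V ⊆ U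

/-- `X` has dimension at most `1` at `x`: every neighbourhood of `x` contains an open neighbourhood
of `x` whose boundary has dimension at most `0`. -/
def DimensionAtLeOne {X : Type*} [TopologicalSpace X] (x : X) : Prop :=
  ∀ U ∈ 𝓝 x, ∃ V : Set X, IsOpen V ∧ x ∈ V ∧ V ⊆ U ∧
    HasSmallInductiveDimensionLE (frontier V) 0

/-- `X` is one-dimensional at `x`. -/
def OneDimensionalAt {X : Type*} [TopologicalSpace X] (x : X) : Prop :=
  DimensionAtLeOne x ∧ ¬ ZeroDimensionalAt x

/-- The dimensional kernel `Λ(X)`, the set of points at which `X` is one-dimensional. -/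
def kernel (X : Type*) [TopologicalSpace X] : Set X :=
  {x | OneDimensionalAt x}

/-- `X` is weakly one-dimensional: it has dimension `1`, but its dimensional kernel has
dimension `0`. -/
def IsWeaklyOneDimensional (X : Type*) [TopologicalSpace X] : Prop :=
  dim X = 1 ∧ dim (kernel X) = 0

/-- The point at height `t` on the segment from the vertex `(0, 0)` to `(c, 1)`. -/
def conePoint (p : cantorSet × unitInterval) : ℝ × ℝ :=
  ((p.2 : ℝ) * (p.1 : ℝ), (p.2 : ℝ))

/-- The Cantor fan, that is, the cone over the Cantor set, realized in the plane as the union of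
the segments from the vertex `(0, 0)` to the points `(c, 1)` with `c` in the Cantor set. -/
def cantorFan : Set (ℝ × ℝ) := range conePoint

/-- The planar Cantor fan is the topological cone: the quotient of `C × [0, 1]` which collapses
`C × {0}` to a point and makes no other identification. -/
theorem isQuotientMap_conePoint :
    IsQuotientMap (rangeFactorization conePoint : cantorSet × unitInterval → cantorFan) ∧
    ∀ p q : cantorSet × unitInterval, conePoint p = conePoint q ↔
      p = q ∨ (p.2 = 0 ∧ q.2 = 0) := by
  have hc : Continuous conePoint := by unfold conePoint; fun_prop
  have : CompactSpace cantorSet := isCompact_iff_compactSpace.mp isCompact_cantorSet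
  constructor
  · have h : Continuous (rangeFactorization conePoint) := hc.subtype_mk _
    exact h.isClosedMap.isQuotientMap h rangeFactorization_surjective
  · rintro ⟨c, t⟩ ⟨d, s⟩
    simp only [conePoint, Prod.mk.injEq]
    constructor
    · rintro ⟨h1, h2⟩
      have hts : t = s := Subtype.ext h2
      subst hts
      by_cases ht : t = 0
      · exact Or.inr ⟨ht, ht⟩
      · have ht' : (t : ℝ) ≠ 0 := fun h => ht (Subtype.ext h)
        exact Or.inl ⟨Subtype.ext (mul_left_cancel₀ ht' h1), rfl⟩
    · rintro (⟨rfl, rfl⟩ | ⟨rfl, rfl⟩) <;> simp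

/-- A smooth fan: a compact, connected subset of the Cantor fan. -/
def IsSmoothFan (X : Set (ℝ × ℝ)) : Prop :=
  X ⊆ cantorFan ∧ IsCompact X ∧ IsConnected X

/-- The set `E(X)` of endpoints of `X`: the points of `X` which are an endpoint of every arc
(a homeomorphic copy of `[0, 1]`) in `X` that contains them. -/
def endpoints {S : Type*} [TopologicalSpace S] (X : Set S) : Set S :=
  {x | x ∈ X ∧ ∀ f : unitInterval → S, IsEmbedding f → range f ⊆ X → x ∈ range f →
    x = f 0 ∨ x = f 1}

end SmoothFan

end

/-!
Every point of a smooth fan `X` with at least two segments is `(t c, t)` for some `c` in the Cantor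
set, and `X` is star-shaped about the vertex, so the endpoints form the graph of a function on a
subset of the Cantor set. By compactness this function is upper semicontinuous: the points of `X`
of height at least `t` form a compact set, and its set of slopes is closed. (If `X` lies in one
segment, there are at most two endpoints.) It thus suffices to show that the graph `Y` of an upper
semicontinuous function `φ` on a subset of a zero-dimensional compact space is zero-dimensional as
soon as its kernel `Λ` is; as `Y` has dimension at most one at every point, `Λ` consists of the
points at which `Y` is not zero-dimensional.

By second countability, the topology of the base can be refined by countably many clopen subsets of
`Y` so that `φ` becomes continuous at all points outside `Λ` (`exists_clopen_sequence`). The refined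
topology is encoded by the cylinders of a sequence of clopen sets, which are the balls of an
ultrametric. The set `D` of points at which `φ` oscillates by at least `ε` in this topology is then
closed and contained in `Λ`, hence it is zero-dimensional as a subspace of `Y`, and a small
relatively clopen set `P` of `D` has to be extended to a clopen set of `Y`. The maximal cylinders on
which `φ` oscillates by less than `ε` partition the complement of `D`. Sending each of these cells
to a point of `D` which nearly minimizes the distance, and nearly maximizes the height, gives a map
into `D` which is continuous at the points of `D`: upper semicontinuity bounds the height from the
other side (`exists_cell_retraction`). The clopen set consists of `P` and of the cells which are
sent into `P` and reach the height of `P`; as `φ` is nearly constant on cells, it is small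
(`zeroDimensionalAt_of_forall_subtype`).
-/

namespace SmoothFan

/-! ### Cylinders and cells of a sequence of sets -/

section Cylinder

variable {Y : Type*} {B : ℕ → Set Y} {φ : Y → ℝ} {ε : ℝ}

/-- The points which the sets `B 0, …, B (n - 1)` do not distinguish from `x`. For varying `n`
these are the balls of an ultrametric. -/
def cylinder (B : ℕ → Set Y) (n : ℕ) (x : Y) : Set Y :=
  {z | ∀ k < n, (z ∈ B k ↔ x ∈ B k)}

lemma mem_cylinder_self (n : ℕ) (x : Y) : x ∈ cylinder B n x := fun _ _ => Iff.rfl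

lemma mem_cylinder_comm {n : ℕ} {x z : Y} : z ∈ cylinder B n x ↔ x ∈ cylinder B n z :=
  ⟨fun h k hk => (h k hk).symm, fun h k hk => (h k hk).symm⟩

lemma cylinder_antitone {m n : ℕ} (h : m ≤ n) (x : Y) : cylinder B n x ⊆ cylinder B m x :=
  fun _ hz k hk => hz k (hk.trans_le h)

lemma cylinder_eq_of_mem {n : ℕ} {x z : Y} (h : z ∈ cylinder B n x) :
    cylinder B n z = cylinder B n x := by
  ext w
  exact ⟨fun hw k hk => (hw k hk).trans (h k hk), fun hw k hk => (hw k hk).trans (h k hk).symm⟩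

lemma cylinder_subset_of_mem {n : ℕ} {x : Y} (h : x ∈ B n) : cylinder B (n + 1) x ⊆ B n :=
  fun _ hz => (hz n n.lt_succ_self).2 h

lemma isClopen_cylinder [TopologicalSpace Y] (hB : ∀ n, IsClopen (B n)) (n : ℕ) (x : Y) :
    IsClopen (cylinder B n x) := by
  have : cylinder B n x = ⋂ k ∈ Finset.range n, {z | z ∈ B k ↔ x ∈ B k} := by
    ext z; simp [cylinder]
  rw [this]
  refine isClopen_biInter_finset fun k _ => ?_
  by_cases hx : x ∈ B k
  · simpa [hx] using hB k
  · convert (hB k).compl using 1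
    ext; simp [hx]

/-- The points at which the oscillation of `φ`, measured on cylinders, is at least `ε`. -/
def oscSet (B : ℕ → Set Y) (φ : Y → ℝ) (ε : ℝ) : Set Y :=
  {x | ∀ n, ∃ z ∈ cylinder B n x, ∃ w ∈ cylinder B n x, ε ≤ φ z - φ w}

lemma notMem_oscSet_iff {x : Y} : x ∉ oscSet B φ ε ↔
    ∃ n, ∀ z ∈ cylinder B n x, ∀ w ∈ cylinder B n x, φ z - φ w < ε := by
  simp only [oscSet, mem_ofPred_eq]
  push Not
  rfl

/-- The index of the largest cylinder around `x` on which `φ` oscillates by less than `ε`;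
the junk value is `0` if `x ∈ oscSet B φ ε`. -/
noncomputable def cellLevel (B : ℕ → Set Y) (φ : Y → ℝ) (ε : ℝ) (x : Y) : ℕ :=
  sInf {n | ∀ z ∈ cylinder B n x, ∀ w ∈ cylinder B n x, φ z - φ w < ε}

/-- The largest cylinder around `x` on which `φ` oscillates by less than `ε`. Only meaningful for
`x ∉ oscSet B φ ε`; these cells partition the complement of `oscSet B φ ε`. -/
noncomputable def cell (B : ℕ → Set Y) (φ : Y → ℝ) (ε : ℝ) (x : Y) : Set Y :=
  cylinder B (cellLevel B φ ε x) x

lemma mem_cell_self (x : Y) : x ∈ cell B φ ε x := mem_cylinder_self _ _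

lemma sub_lt_of_mem_cell {x z w : Y} (hx : x ∉ oscSet B φ ε) (hz : z ∈ cell B φ ε x)
    (hw : w ∈ cell B φ ε x) : φ z - φ w < ε :=
  Nat.sInf_mem (notMem_oscSet_iff.1 hx) z hz w hw

lemma notMem_oscSet_of_mem_cell {x z : Y} (hx : x ∉ oscSet B φ ε) (hz : z ∈ cell B φ ε x) :
    z ∉ oscSet B φ ε := by
  refine notMem_oscSet_iff.2 ⟨cellLevel B φ ε x, ?_⟩
  rw [cylinder_eq_of_mem hz]
  exact fun u hu v hv => sub_lt_of_mem_cell hx hu hv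

lemma cell_eq_of_mem {x z : Y} (hx : x ∉ oscSet B φ ε) (hz : z ∈ cell B φ ε x) :
    cell B φ ε z = cell B φ ε x := by
  have hz' := notMem_oscSet_of_mem_cell hx hz
  have h1 : cellLevel B φ ε z ≤ cellLevel B φ ε x := by
    refine Nat.sInf_le ?_
    rw [mem_ofPred_eq, cylinder_eq_of_mem hz]
    exact fun u hu v hv => sub_lt_of_mem_cell hx hu hv
  have h2 : cylinder B (cellLevel B φ ε z) z = cylinder B (cellLevel B φ ε z) x :=
    cylinder_eq_of_mem (cylinder_antitone h1 x hz)
  have h3 : cellLevel B φ ε x ≤ cellLevel B φ ε z := by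
    refine Nat.sInf_le ?_
    rw [mem_ofPred_eq, ← h2]
    exact fun u hu v hv => sub_lt_of_mem_cell hz' hu hv
  rw [cell, h2, le_antisymm h1 h3, cell]

/-- Cells are small near `oscSet B φ ε`. -/
lemma lt_cellLevel {x d : Y} {m : ℕ} (hx : x ∉ oscSet B φ ε) (hd : d ∈ oscSet B φ ε)
    (h : x ∈ cylinder B m d) : m < cellLevel B φ ε x := by
  by_contra! hle
  exact notMem_oscSet_of_mem_cell hx (cylinder_antitone hle x (mem_cylinder_comm.1 h)) hd

lemma cell_subset_cylinder {x d : Y} {m : ℕ} (hx : x ∉ oscSet B φ ε) (hd : d ∈ oscSet B φ ε)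
    (h : x ∈ cylinder B m d) : cell B φ ε x ⊆ cylinder B m d := by
  rw [← cylinder_eq_of_mem h]
  exact cylinder_antitone (lt_cellLevel hx hd h).le x

/-- The retraction onto `oscSet B φ ε`: a cell is sent to a point of this set which is, up to the
scale `M`, both close to the cell and not lower than it, for the best possible `M`. -/
lemma exists_cell_retraction [Nonempty Y] (B : ℕ → Set Y) (φ : Y → ℝ) (ε : ℝ) :
    ∃ r : Set Y → Y, ∀ x ∉ oscSet B φ ε, ∀ (M : ℕ), ∀ d ∈ oscSet B φ ε,
      x ∈ cylinder B M d → (∀ z ∈ cell B φ ε x, φ z < φ d + 1 / (M + 1)) →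
      r (cell B φ ε x) ∈ oscSet B φ ε ∧ x ∈ cylinder B M (r (cell B φ ε x)) ∧
        φ x < φ (r (cell B φ ε x)) + 1 / (M + 1) := by
  let Q (K : Set Y) (M : ℕ) (d : Y) : Prop :=
    d ∈ oscSet B φ ε ∧ K ⊆ cylinder B M d ∧ ∀ z ∈ K, φ z < φ d + 1 / (M + 1)
  have hQ : ∀ {K M N d}, M ≤ N → Q K N d → Q K M d := by
    intro K M N d hMN h
    refine ⟨h.1, h.2.1.trans (cylinder_antitone hMN d), fun z hz => (h.2.2 z hz).trans_le ?_⟩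
    gcongr
  have key : ∀ K : Set Y, ∃ r : Y, ∀ x ∉ oscSet B φ ε, cell B φ ε x = K →
      ∀ M d, Q K M d → Q K M r := by
    intro K
    by_cases hK : ∃ x ∉ oscSet B φ ε, cell B φ ε x = K ∧ ∃ M d, Q K M d
    · obtain ⟨x, hx, rfl, hne⟩ := hK
      have hbdd : BddAbove {M | ∃ d, Q (cell B φ ε x) M d} :=
        ⟨cellLevel B φ ε x, fun M ⟨d, hd⟩ =>
          (lt_cellLevel hx hd.1 (hd.2.1 (mem_cell_self x))).le⟩
      obtain ⟨r, hr⟩ := Nat.sSup_mem hne hbdd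
      exact ⟨r, fun _ _ _ M d hd => hQ (le_csSup hbdd ⟨d, hd⟩) hr⟩
    · push Not at hK
      exact ⟨Classical.arbitrary Y, fun x hx hxK M d hd => absurd hd (hK x hx hxK M d)⟩
  choose r hr using key
  refine ⟨r, fun x hx M d hd hxd hφ => ?_⟩
  obtain ⟨h1, h2, h3⟩ := hr _ x hx rfl M d ⟨hd, cell_subset_cylinder hx hd hxd, hφ⟩
  exact ⟨h1, h2 (mem_cell_self x), h3 x (mem_cell_self x)⟩

/-- Suppose that, at every point, `φ` is upper semicontinuous with respect to cylinders, and that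
cylinders together with lower bounds on `φ` form neighbourhood bases. If `Λ` is zero-dimensional
and contains all points at which `φ` fails to be lower semicontinuous with respect to cylinders,
then the whole space is zero-dimensional. -/
theorem zeroDimensionalAt_of_forall_subtype [TopologicalSpace Y] (hφ : Continuous φ)
    (hB : ∀ n, IsClopen (B n))
    (husc : ∀ x, ∀ δ > 0, ∃ n, ∀ z ∈ cylinder B n x, φ z < φ x + δ)
    (hnhds : ∀ x, ∀ U ∈ 𝓝 x, ∃ n, ∃ δ > 0, ∀ z ∈ cylinder B n x, φ x - δ < φ z → z ∈ U)
    (Λ : Set Y) (hlsc : ∀ x ∉ Λ, ∀ δ > 0, ∃ n, ∀ z ∈ cylinder B n x, φ x - δ < φ z)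
    (hΛ : ∀ x : Λ, ZeroDimensionalAt x) (x₀ : Y) : ZeroDimensionalAt x₀ := by
  intro U hU
  obtain ⟨n₀, δ, hδ, hUδ⟩ := hnhds x₀ U hU
  set ε := δ / 2 with hε
  set D := oscSet B φ ε with hD
  have hcyl := isClopen_cylinder hB
  have hcell : ∀ x, IsOpen (cell B φ ε x) := fun x => (hcyl _ x).isOpen
  by_cases hx₀ : x₀ ∉ D
  · obtain ⟨n, hn⟩ := notMem_oscSet_iff.1 hx₀
    refine ⟨_, (hcyl n₀ x₀).inter (hcyl n x₀),
      ⟨mem_cylinder_self _ _, mem_cylinder_self _ _⟩, fun z hz => hUδ z hz.1 ?_⟩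
    linarith [hn x₀ (mem_cylinder_self _ _) z hz.2]
  rw [not_not] at hx₀
  have hDΛ : D ⊆ Λ := by
    intro x hx
    by_contra hxΛ
    obtain ⟨m, hm⟩ := husc x (ε / 2) (by positivity)
    obtain ⟨n, hn⟩ := hlsc x hxΛ (ε / 2) (by positivity)
    obtain ⟨z, hz, w, hw, hzw⟩ := hx (max m n)
    linarith [hm z (cylinder_antitone (le_max_left _ _) x hz),
      hn w (cylinder_antitone (le_max_right _ _) x hw)]
  -- A relatively clopen piece `P` of `D`, well inside the given neighbourhood.
  obtain ⟨S, hS, hx₀S, hSU⟩ := hΛ ⟨x₀, hDΛ hx₀⟩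
    (Subtype.val ⁻¹' (cylinder B n₀ x₀ ∩ {z | φ x₀ - ε < φ z})) <| by
      refine IsOpen.mem_nhds ?_ ⟨mem_cylinder_self _ _, ?_⟩
      · exact ((hcyl n₀ x₀).isOpen.inter (isOpen_lt continuous_const hφ)).preimage
          continuous_subtype_val
      · simp only [mem_ofPred_eq]; linarith
  obtain ⟨O, hO, rfl⟩ := isOpen_induced_iff.1 hS.isOpen
  obtain ⟨O', hO', hOO'⟩ := isOpen_induced_iff.1 hS.compl.isOpen
  have hmem' : ∀ d ∈ D, (d ∈ O' ↔ d ∉ O) := fun d hd => by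
    have := congrArg (fun s : Set Λ => (⟨d, hDΛ hd⟩ : Λ) ∈ s) hOO'
    simpa using this
  have hOU : ∀ d ∈ D, d ∈ O → d ∈ cylinder B n₀ x₀ ∧ φ x₀ - ε < φ d := fun d hd hdO =>
    hSU (show (⟨d, hDΛ hd⟩ : Λ) ∈ Subtype.val ⁻¹' O from hdO)
  have : Nonempty Y := ⟨x₀⟩
  obtain ⟨r, hr⟩ := exists_cell_retraction B φ ε
  -- The retraction is continuous at the points of `D`.
  have hr_nhds : ∀ x ∈ D, ∀ W ∈ 𝓝 x, ∀ᶠ z in 𝓝 x, z ∉ D →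
      r (cell B φ ε z) ∈ D ∧ r (cell B φ ε z) ∈ W := by
    intro x hx W hW
    obtain ⟨m, η, hη, hWη⟩ := hnhds x W hW
    obtain ⟨k, hk⟩ := exists_nat_one_div_lt (half_pos hη)
    set M := max m k with hM
    have hMk : 1 / ((M : ℝ) + 1) < η / 2 := by
      refine lt_of_le_of_lt ?_ hk
      have : (k : ℝ) ≤ M := by exact_mod_cast le_max_right m k
      gcongr
    obtain ⟨n, hn⟩ := husc x (1 / (M + 1)) (by positivity)
    have h1 : ∀ᶠ z in 𝓝 x, z ∈ cylinder B (max M n) x :=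
      (hcyl _ x).isOpen.mem_nhds (mem_cylinder_self _ _)
    have h2 : ∀ᶠ z in 𝓝 x, φ x - η / 2 < φ z :=
      hφ.continuousAt.eventually_const_lt (by linarith)
    filter_upwards [h1, h2] with z hz1 hz2 hzD
    have hzM := cylinder_antitone (le_max_left M n) x hz1
    obtain ⟨h3, h4, h5⟩ := hr z hzD M x hx hzM fun w hw =>
      hn w (cylinder_antitone (le_max_right M n) x (cell_subset_cylinder hzD hx hz1 hw))
    refine ⟨h3, hWη _ ?_ (by linarith)⟩
    rw [← cylinder_eq_of_mem (cylinder_antitone (le_max_left m k) x hzM), mem_cylinder_comm]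
    exact cylinder_antitone (le_max_left m k) _ h4
  -- `V` consists of `P = D ∩ O` and of the cells which are retracted into `P` and which reach
  -- above the level `φ x₀ - ε`; such cells stay above `φ x₀ - 2 ε = φ x₀ - δ`.
  set V : Set Y := {z | (z ∈ D → z ∈ O) ∧ (z ∉ D → z ∈ cylinder B n₀ x₀ ∧
    (∃ w ∈ cell B φ ε z, φ x₀ - ε < φ w) ∧ r (cell B φ ε z) ∈ O)} with hV
  have hoff : ∀ x ∉ D, ∀ᶠ z in 𝓝 x, (z ∈ V ↔ x ∈ V) := by
    intro x hx
    filter_upwards [(hcell x).mem_nhds (mem_cell_self x),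
      (hcyl n₀ x).isOpen.mem_nhds (mem_cylinder_self n₀ x)] with z hz hzn
    have hzD : z ∉ D := notMem_oscSet_of_mem_cell hx hz
    have hzx : z ∈ cylinder B n₀ x₀ ↔ x ∈ cylinder B n₀ x₀ := by
      rw [mem_cylinder_comm, cylinder_eq_of_mem hzn, mem_cylinder_comm]
    simp [hV, hzD, hx, cell_eq_of_mem hx hz, hzx]
  refine ⟨V, ⟨⟨?_⟩, ?_⟩, ⟨fun _ => hx₀S, fun h => absurd hx₀ h⟩, ?_⟩
  · refine isOpen_iff_mem_nhds.2 fun x hx => ?_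
    by_cases hxD : x ∈ D
    · have hxO' : x ∈ O' := by
        rw [hmem' x hxD]
        exact fun hxO => hx ⟨fun _ => hxO, fun h => absurd hxD h⟩
      filter_upwards [hr_nhds x hxD O' (hO'.mem_nhds hxO'), hO'.mem_nhds hxO'] with z hz hzO' hzV
      by_cases hzD : z ∈ D
      · exact (hmem' z hzD).1 hzO' (hzV.1 hzD)
      · exact (hmem' _ (hz hzD).1).1 (hz hzD).2 (hzV.2 hzD).2.2
    · filter_upwards [hoff x hxD] with z hz
      exact fun hzV => hx (hz.1 hzV)
  · refine isOpen_iff_mem_nhds.2 fun x hx => ?_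
    by_cases hxD : x ∈ D
    · have hxO := hx.1 hxD
      obtain ⟨hxn, hxφ⟩ := hOU x hxD hxO
      filter_upwards [hr_nhds x hxD O (hO.mem_nhds hxO), hO.mem_nhds hxO,
        (hcyl n₀ x₀).isOpen.mem_nhds hxn, hφ.continuousAt.eventually_const_lt hxφ]
        with z hz hzO hzn hzφ
      exact ⟨fun _ => hzO, fun hzD => ⟨hzn, ⟨z, mem_cell_self z, hzφ⟩, (hz hzD).2⟩⟩
    · filter_upwards [hoff x hxD] with z hz
      exact hz.2 hx
  · intro z hz
    by_cases hzD : z ∈ D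
    · obtain ⟨h1, h2⟩ := hOU z hzD (hz.1 hzD)
      exact hUδ z h1 (by linarith)
    · obtain ⟨h1, ⟨w, hw, hwφ⟩, -⟩ := hz.2 hzD
      exact hUδ z h1 (by linarith [sub_lt_of_mem_cell hzD hw (mem_cell_self z)])

end Cylinder

/-! ### Dimension zero and one -/

lemma hasSmallInductiveDimensionLE_zero_iff {X : Type*} [TopologicalSpace X] :
    HasSmallInductiveDimensionLE X 0 ↔ ∀ x : X, ZeroDimensionalAt x := by
  refine hasSmallInductiveDimensionLT_one_iff.trans ⟨fun h x U hU => ?_, fun h => ?_⟩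
  · exact h.mem_nhds_iff.1 hU
  · exact TopologicalSpace.isTopologicalBasis_of_isOpen_of_nhds (fun U hU => hU.isOpen)
      fun x U hx hU => h x U (hU.mem_nhds hx)

lemma dimensionAtLeOne_of_hasSmallInductiveDimensionLE {X : Type*} [TopologicalSpace X]
    (h : HasSmallInductiveDimensionLE X 1) (x : X) : DimensionAtLeOne x := by
  intro U hU
  obtain - | ⟨_, s, hs, h⟩ := h
  obtain ⟨V, hV, hxV, hVU⟩ := hs.mem_nhds_iff.1 hU
  exact ⟨V, hs.isOpen hV, hxV, hVU, h V hV⟩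

lemma dim_eq_zero_iff {X : Type*} [TopologicalSpace X] :
    dim X = 0 ↔ HasSmallInductiveDimensionLE X 0 := by
  rw [← smallInductiveDimension_le_iff, dim]
  induction smallInductiveDimension X <;> simp

lemma dim_le_one {X : Type*} [TopologicalSpace X] (h : HasSmallInductiveDimensionLE X 1) :
    dim X ≤ 1 := by
  rw [← smallInductiveDimension_le_iff] at h
  rw [dim]
  induction hX : smallInductiveDimension X
  · simp
  · rw [hX] at h
    exact_mod_cast h

lemma dim_eq_one {X : Type*} [TopologicalSpace X] (h1 : HasSmallInductiveDimensionLE X 1)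
    (h0 : ¬ HasSmallInductiveDimensionLE X 0) : dim X = 1 :=
  (dim_le_one h1).antisymm (Order.one_le_iff_ne_zero.2 fun h => h0 (dim_eq_zero_iff.1 h))

/-- If `Y` is zero-dimensional, then its kernel is empty; if `Y` is one-dimensional, it suffices
that the kernel is not zero-dimensional. -/
lemma dim_kernel_eq_dim {Y : Type*} [TopologicalSpace Y] (h1 : HasSmallInductiveDimensionLE Y 1)
    (hk1 : HasSmallInductiveDimensionLE (kernel Y) 1)
    (hk : HasSmallInductiveDimensionLE (kernel Y) 0 → HasSmallInductiveDimensionLE Y 0) :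
    dim (kernel Y) = dim Y := by
  by_cases h0 : HasSmallInductiveDimensionLE Y 0
  · have : IsEmpty (kernel Y) :=
      ⟨fun x => x.2.2 (hasSmallInductiveDimensionLE_zero_iff.1 h0 x)⟩
    rw [dim_eq_zero_iff.2 h0, dim_eq_zero_iff]
    infer_instance
  · rw [dim_eq_one h1 h0, dim_eq_one hk1 (mt hk h0)]

/-! ### Spaces over a zero-dimensional compact space -/

section Product

variable {C : Type*} [TopologicalSpace C] [CompactSpace C] [T2Space C] [TotallyDisconnectedSpace C]

/-- A basis of neighbourhoods in a subspace of `C × ℝ`. -/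
lemma exists_isClopen_of_isInducing {S : Type*} [TopologicalSpace S] {π : S → C} {φ : S → ℝ}
    (h : IsInducing fun s => (π s, φ s)) {x : S} {U : Set S} (hU : U ∈ 𝓝 x) :
    ∃ K : Set C, IsClopen K ∧ π x ∈ K ∧ ∃ δ > 0, ∀ z, π z ∈ K → |φ z - φ x| < δ → z ∈ U := by
  rw [h.nhds_eq_comap, Filter.mem_comap] at hU
  obtain ⟨W, hW, hWU⟩ := hU
  rw [nhds_prod_eq, Filter.mem_prod_iff] at hW
  obtain ⟨O, hO, I, hI, hOI⟩ := hW
  obtain ⟨K, hK, hxK, hKO⟩ := isTopologicalBasis_isClopen.mem_nhds_iff.1 hO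
  obtain ⟨δ, hδ, hδI⟩ := Metric.mem_nhds_iff.1 hI
  exact ⟨K, hK, hxK, δ, hδ, fun z hz hzφ => hWU (hOI ⟨hKO hz, hδI hzφ⟩)⟩

lemma hasSmallInductiveDimensionLE_zero_of_two_values {S : Type*} [TopologicalSpace S]
    {π : S → C} {φ : S → ℝ} (h : IsInducing fun s => (π s, φ s)) {a b : ℝ}
    (hab : ∀ s, φ s = a ∨ φ s = b) : HasSmallInductiveDimensionLE S 0 := by
  have hφ : Continuous φ := h.continuous.snd
  have hπ : Continuous π := h.continuous.fst
  refine hasSmallInductiveDimensionLE_zero_iff.2 fun x U hU => ?_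
  obtain ⟨K, hK, hxK, δ, hδ, hKU⟩ := exists_isClopen_of_isInducing h hU
  refine ⟨π ⁻¹' K ∩ φ ⁻¹' {φ x}, (hK.preimage hπ).inter
    ⟨isClosed_singleton.preimage hφ, ?_⟩, ⟨hxK, rfl⟩, fun z hz => hKU z hz.1 ?_⟩
  · -- The fibre of the value of `φ` at `x` is the complement of the set of the other value.
    have : φ ⁻¹' {φ x} = (φ ⁻¹' ({a, b} \ {φ x}))ᶜ := by
      ext z
      have := hab z
      simp only [mem_preimage, mem_singleton_iff, mem_compl_iff, mem_sdiff, mem_insert_iff]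
      tauto
    rw [this, isOpen_compl_iff]
    exact ((toFinite {a, b}).subset sdiff_subset).isClosed.preimage hφ
  · rw [show φ z = φ x from hz.2]
    simpa using hδ

lemma hasSmallInductiveDimensionLE_one_of_isInducing {S : Type*} [TopologicalSpace S]
    {π : S → C} {φ : S → ℝ} (h : IsInducing fun s => (π s, φ s)) :
    HasSmallInductiveDimensionLE S 1 := by
  have hφ : Continuous φ := h.continuous.snd
  have hπ : Continuous π := h.continuous.fst
  refine .succ 1 {V | ∃ K : Set C, IsClopen K ∧ ∃ a b : ℝ, V = π ⁻¹' K ∩ φ ⁻¹' Ioo a b}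
    (TopologicalSpace.isTopologicalBasis_of_isOpen_of_nhds ?_ fun x U hx hU => ?_) ?_
  · rintro _ ⟨K, hK, a, b, rfl⟩
    exact (hK.isOpen.preimage hπ).inter (isOpen_Ioo.preimage hφ)
  · obtain ⟨K, hK, hxK, δ, hδ, hKU⟩ := exists_isClopen_of_isInducing h (hU.mem_nhds hx)
    refine ⟨_, ⟨K, hK, φ x - δ, φ x + δ, rfl⟩, ⟨hxK, ?_⟩, fun z hz => hKU z hz.1 ?_⟩
    · constructor <;> linarith
    · rw [abs_lt]
      constructor <;> linarith [hz.2.1, hz.2.2]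
  · rintro _ ⟨K, hK, a, b, rfl⟩
    refine hasSmallInductiveDimensionLE_zero_of_two_values (a := a) (b := b)
      (π := fun s => π s.1) (φ := fun s => φ s.1) (h.comp IsInducing.subtypeVal) ?_
    rintro ⟨s, hs⟩
    have hs1 : s ∈ π ⁻¹' K ∩ φ ⁻¹' Icc a b :=
      closure_minimal (inter_subset_inter_right _ (preimage_mono Ioo_subset_Icc_self))
        ((hK.isClosed.preimage hπ).inter (isClosed_Icc.preimage hφ)) hs.1
    have hs2 : s ∉ π ⁻¹' K ∩ φ ⁻¹' Ioo a b := by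
      have := hs.2
      rwa [((hK.isOpen.preimage hπ).inter (isOpen_Ioo.preimage hφ)).interior_eq] at this
    by_contra! hne
    exact hs2 ⟨hs1.1, lt_of_le_of_ne hs1.2.1 hne.1.symm, lt_of_le_of_ne hs1.2.2 hne.2⟩

variable [SecondCountableTopology C]

/-- There is a sequence of clopen sets, containing a prescribed countable family, whose cylinders
make `φ` lower semicontinuous at every point of zero-dimensionality: clopen sets on which `φ`
oscillates little cover these points, and countably many suffice by second countability. -/
lemma exists_clopen_sequence {Y : Type*} [TopologicalSpace Y] [SecondCountableTopology Y]
    {φ : Y → ℝ} (hφ : Continuous φ) {𝓢 : Set (Set Y)} (h𝓢 : 𝓢.Countable)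
    (h𝓢' : ∀ S ∈ 𝓢, IsClopen S) :
    ∃ B : ℕ → Set Y, (∀ n, IsClopen (B n)) ∧ (∀ S ∈ 𝓢, ∃ n, B n = S) ∧
      ∀ x, ZeroDimensionalAt x → ∀ δ > 0, ∃ n, x ∈ B n ∧ ∀ z ∈ B n, φ x - δ < φ z := by
  let G (k : ℕ) : Set (Set Y) :=
    {V | IsClopen V ∧ ∀ z ∈ V, ∀ w ∈ V, φ z - φ w < 1 / (k + 1)}
  have hG : ∀ k, ∃ T : Set (Set Y), T.Countable ∧ T ⊆ G k ∧ ⋃₀ T = ⋃₀ G k := fun k =>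
    TopologicalSpace.isOpen_sUnion_countable _ fun V hV => hV.1.isOpen
  choose T hTc hTG hTU using hG
  obtain ⟨B, hB⟩ := ((h𝓢.union (countable_iUnion hTc)).insert univ).exists_eq_range
    (insert_nonempty _ _)
  have hmem : ∀ V, (V = univ ∨ V ∈ 𝓢 ∨ ∃ k, V ∈ T k) ↔ ∃ n, B n = V := fun V => by
    rw [← mem_range, ← hB]; simp
  refine ⟨B, fun n => ?_, fun S hS => (hmem S).1 (Or.inr (Or.inl hS)), fun x hx δ hδ => ?_⟩
  · obtain h | h | ⟨k, h⟩ := (hmem (B n)).2 ⟨n, rfl⟩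
    · rw [h]; exact isClopen_univ
    · exact h𝓢' _ h
    · exact (hTG k h).1
  · obtain ⟨k, hk⟩ := exists_nat_one_div_lt hδ
    have hpos : (0 : ℝ) < 1 / (k + 1) / 2 := by positivity
    obtain ⟨V, hV, hxV, hVφ⟩ := hx (φ ⁻¹' Metric.ball (φ x) (1 / (k + 1) / 2))
      (hφ.continuousAt (Metric.ball_mem_nhds _ hpos))
    have hxT : x ∈ ⋃₀ T k := by
      rw [hTU]
      refine ⟨V, ⟨hV, fun z hz w hw => ?_⟩, hxV⟩
      have h1 := abs_lt.1 (show |φ z - φ x| < _ from hVφ hz)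
      have h2 := abs_lt.1 (show |φ w - φ x| < _ from hVφ hw)
      linarith [h1.2, h2.1]
    obtain ⟨W, hW, hxW⟩ := hxT
    obtain ⟨n, rfl⟩ := (hmem W).1 (Or.inr (Or.inr ⟨k, hW⟩))
    exact ⟨n, hxW, fun z hz => by linarith [(hTG k hW).2 x hxW z hz]⟩

/-- The dimensional kernel of the graph of an upper semicontinuous function on a subset of `C` has
the dimension of the graph. The function is given by the height `φ` over the base point `π`. -/
theorem dim_kernel_eq_dim_of_isInducing {Y : Type*} [TopologicalSpace Y] {π : Y → C} {φ : Y → ℝ}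
    (h : IsInducing fun y => (π y, φ y))
    (husc : ∀ x, ∀ δ > 0, ∃ O ∈ 𝓝 (π x), ∀ z, π z ∈ O → φ z < φ x + δ) :
    dim (kernel Y) = dim Y := by
  have hφ : Continuous φ := h.continuous.snd
  have hπ : Continuous π := h.continuous.fst
  have h1 : HasSmallInductiveDimensionLE Y 1 := hasSmallInductiveDimensionLE_one_of_isInducing h
  refine dim_kernel_eq_dim h1 (hasSmallInductiveDimensionLE_one_of_isInducing
    (π := fun s : kernel Y => π s.1) (φ := fun s => φ s.1) (h.comp IsInducing.subtypeVal))
    fun hk => ?_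
  have : SecondCountableTopology Y := h.secondCountableTopology
  have : Countable (TopologicalSpace.Clopens C) :=
    TopologicalSpace.Clopens.countable_iff_secondCountable.2 inferInstance
  obtain ⟨B, hB, hBC, hlsc⟩ := exists_clopen_sequence hφ
    (𝓢 := range fun K : TopologicalSpace.Clopens C => π ⁻¹' K) (countable_range _)
    (by rintro _ ⟨K, rfl⟩; exact K.isClopen.preimage hπ)
  -- Clopen neighbourhoods in `C` pull back to sets containing cylinders.
  have hcyl : ∀ x (K : Set C), IsClopen K → π x ∈ K → ∃ n, cylinder B n x ⊆ π ⁻¹' K := by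
    intro x K hK hx
    obtain ⟨n, hn⟩ := hBC _ ⟨⟨K, hK⟩, rfl⟩
    refine ⟨n + 1, (cylinder_subset_of_mem ?_).trans hn.subset⟩
    rw [hn]; exact hx
  have husc' : ∀ x, ∀ δ > 0, ∃ n, ∀ z ∈ cylinder B n x, φ z < φ x + δ := by
    intro x δ hδ
    obtain ⟨O, hO, hOφ⟩ := husc x δ hδ
    obtain ⟨K, hK, hxK, hKO⟩ := isTopologicalBasis_isClopen.mem_nhds_iff.1 hO
    obtain ⟨n, hn⟩ := hcyl x K hK hxK
    exact ⟨n, fun z hz => hOφ z (hKO (hn hz))⟩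
  refine hasSmallInductiveDimensionLE_zero_iff.2 (zeroDimensionalAt_of_forall_subtype hφ hB husc'
    (fun x U hU => ?_) (kernel Y) (fun x hx δ hδ => ?_)
    (hasSmallInductiveDimensionLE_zero_iff.1 hk))
  · obtain ⟨K, hK, hxK, δ, hδ, hKU⟩ := exists_isClopen_of_isInducing h hU
    obtain ⟨n, hn⟩ := hcyl x K hK hxK
    obtain ⟨m, hm⟩ := husc' x δ hδ
    refine ⟨max n m, δ, hδ, fun z hz hzφ =>
      hKU z (hn (cylinder_antitone (le_max_left _ _) x hz)) ?_⟩
    rw [abs_lt]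
    constructor <;> linarith [hm z (cylinder_antitone (le_max_right _ _) x hz)]
  · have hx0 : ZeroDimensionalAt x := by
      by_contra hx0
      exact hx ⟨dimensionAtLeOne_of_hasSmallInductiveDimensionLE h1 x, hx0⟩
    obtain ⟨n, hxn, hn⟩ := hlsc x hx0 δ hδ
    exact ⟨n + 1, fun z hz => hn z (cylinder_subset_of_mem hxn hz)⟩

end Product

/-! ### Geometry of smooth fans -/

instance : CompactSpace cantorSet := isCompact_iff_compactSpace.mp isCompact_cantorSet

instance : TotallyDisconnectedSpace cantorSet :=
  cantorSetHomeomorphNatToBool.symm.totallyDisconnectedSpace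

lemma continuous_conePoint : Continuous conePoint := by
  unfold conePoint; fun_prop

@[simp] lemma conePoint_zero (c : cantorSet) : conePoint (c, 0) = 0 := by
  simp [conePoint]

lemma smul_conePoint (c : cantorSet) (r t : unitInterval) :
    (r : ℝ) • conePoint (c, t) = conePoint (c, r * t) := by
  simp [conePoint, mul_assoc]

lemma conePoint_eq_iff {p q : cantorSet × unitInterval} :
    conePoint p = conePoint q ↔ p = q ∨ (p.2 = 0 ∧ q.2 = 0) :=
  isQuotientMap_conePoint.2 p q

section Connected

variable {X : Set (ℝ × ℝ)}

/-- Connectedness of `X`, in terms of closed covers of `C × [0, 1]`. -/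
lemma exists_conePoint_eq_conePoint (hX : X ⊆ cantorFan) (hc : IsPreconnected X)
    {A B : Set (cantorSet × unitInterval)} (hA : IsClosed A) (hB : IsClosed B)
    (hAB : ∀ p, p ∈ A ∨ p ∈ B) {p q : cantorSet × unitInterval} (hp : p ∈ A)
    (hpX : conePoint p ∈ X) (hq : q ∈ B) (hqX : conePoint q ∈ X) :
    ∃ a ∈ A, ∃ b ∈ B, conePoint a = conePoint b ∧ conePoint a ∈ X := by
  obtain ⟨z, hz, ⟨a, ha, rfl⟩, b, hb, hab⟩ := isPreconnected_closed_iff.1 hc _ _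
    (hA.isCompact.image continuous_conePoint).isClosed
    (hB.isCompact.image continuous_conePoint).isClosed
    (fun z hz => by
      obtain ⟨p, rfl⟩ := hX hz
      exact (hAB p).imp (mem_image_of_mem _) (mem_image_of_mem _))
    ⟨_, hpX, mem_image_of_mem _ hp⟩ ⟨_, hqX, mem_image_of_mem _ hq⟩
  exact ⟨a, ha, b, hb, hab.symm, hz⟩

/-- A connected subset of the fan which meets two different segments contains the vertex. -/
lemma zero_mem_of_fst_ne (hX : X ⊆ cantorFan) (hc : IsPreconnected X)
    {p q : cantorSet × unitInterval} (hp : conePoint p ∈ X) (hq : conePoint q ∈ X)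
    (hpq : p.1 ≠ q.1) : (0 : ℝ × ℝ) ∈ X := by
  obtain ⟨K, hK, hpK, hqK⟩ := compact_exists_isClopen_in_isOpen
    (isOpen_compl_singleton (x := q.1)) hpq
  obtain ⟨⟨c, t⟩, ha, b, hb, hab, haX⟩ := exists_conePoint_eq_conePoint hX hc
    (hK.isClosed.preimage continuous_fst) (hK.compl.isClosed.preimage continuous_fst)
    (fun p => em (p.1 ∈ K)) hpK hp (fun h => hqK h rfl) hq
  obtain rfl | ⟨h0 : t = 0, -⟩ := conePoint_eq_iff.1 hab
  · exact absurd ha hb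
  · rw [h0, conePoint_zero] at haX
    exact haX

/-- A closed connected subset of the fan which contains the vertex is star-shaped: a gap in a
segment would extend to neighbouring segments and disconnect the set. -/
lemma conePoint_mem_of_le (hX : X ⊆ cantorFan) (hc : IsPreconnected X) (hcl : IsClosed X)
    (h0 : (0 : ℝ × ℝ) ∈ X) {c : cantorSet} {s t : unitInterval} (ht : conePoint (c, t) ∈ X)
    (hst : s ≤ t) : conePoint (c, s) ∈ X := by
  by_contra hs
  have hs0 : 0 < s := by
    refine pos_iff_ne_zero.2 ?_
    rintro rfl
    exact hs (by simpa using h0)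
  obtain ⟨K, hK, hcK, hKX⟩ := compact_exists_isClopen_in_isOpen
    (U := {d : cantorSet | conePoint (d, s) ∉ X})
    (hcl.isOpen_compl.preimage (continuous_conePoint.comp (by fun_prop : Continuous
      fun d : cantorSet => (d, s)))) hs
  obtain ⟨⟨d, u⟩, ha, b, hb, hab, haX⟩ := exists_conePoint_eq_conePoint hX hc
    (A := K ×ˢ Ici s) (B := K ×ˢ Iic s ∪ Kᶜ ×ˢ univ) (p := (c, t)) (q := (c, 0))
    (hK.isClosed.prod isClosed_Ici)
    ((hK.isClosed.prod isClosed_Iic).union (hK.compl.isClosed.prod isClosed_univ))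
    (fun p => by
      simp only [mem_prod, mem_union, mem_Ici, mem_Iic, mem_compl_iff, mem_univ]
      have := le_total s p.2
      tauto)
    ⟨hcK, hst⟩ ht (Or.inl ⟨hcK, hs0.le⟩) (by simpa using h0)
  obtain rfl | ⟨hu : u = 0, -⟩ := conePoint_eq_iff.1 hab
  · obtain hb | hb := hb
    · obtain rfl : u = s := le_antisymm hb.2 ha.2
      exact hKX ha.1 haX
    · exact hb.1 ha.1
  · subst hu
    exact absurd ha.2 (not_le.2 hs0)

lemma smul_mem_of_isPreconnected (hX : X ⊆ cantorFan) (hc : IsPreconnected X) (hcl : IsClosed X)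
    (h0 : (0 : ℝ × ℝ) ∈ X) {z : ℝ × ℝ} (hz : z ∈ X) {r : ℝ} (hr : r ∈ Icc (0 : ℝ) 1) :
    r • z ∈ X := by
  obtain ⟨⟨c, t⟩, rfl⟩ := hX hz
  have := smul_conePoint c ⟨r, hr⟩ t
  rw [this]
  exact conePoint_mem_of_le hX hc hcl h0 hz unitInterval.mul_le_right

/-- Endpoints lie at the top of their segments. -/
lemma le_of_conePoint_mem_endpoints (hX : X ⊆ cantorFan) (hc : IsPreconnected X)
    (hcl : IsClosed X) (h0 : (0 : ℝ × ℝ) ∈ X) {c : cantorSet} {s t : unitInterval} (hs : s ≠ 0)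
    (hsX : conePoint (c, s) ∈ endpoints X) (htX : conePoint (c, t) ∈ X) : t ≤ s := by
  by_contra! hst
  have ht0 : (0 : ℝ) < t := (unitInterval.nonneg s).trans_lt hst
  have hinj : ∀ {u v : unitInterval}, conePoint (c, u) = conePoint (c, v) → u = v :=
    fun h => Subtype.ext (congrArg Prod.snd h)
  have hf : IsEmbedding fun u : unitInterval => conePoint (c, u * t) := by
    refine (Continuous.isClosedEmbedding (continuous_conePoint.comp (by fun_prop)) ?_).isEmbedding
    intro u v huv
    have : (u : ℝ) * t = v * t := congrArg Subtype.val (hinj huv)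
    exact Subtype.ext (mul_right_cancel₀ ht0.ne' this)
  obtain h | h := hsX.2 _ hf
    (by
      rintro _ ⟨u, rfl⟩
      exact conePoint_mem_of_le hX hc hcl h0 htX unitInterval.mul_le_right)
    (by
      let u : unitInterval := ⟨s / t, unitInterval.div_mem s.2.1 t.2.1 hst.le⟩
      have hu : u * t = s := Subtype.ext (div_mul_cancel₀ (s : ℝ) ht0.ne')
      exact ⟨u, by simp only [hu]⟩)
  · exact hs (by simpa using hinj h)
  · exact hst.ne (by simpa using hinj h)

/-- If `X` has two nontrivial segments, then their union is an arc with the vertex inside. -/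
lemma zero_notMem_endpoints (hX : X ⊆ cantorFan) (hc : IsPreconnected X)
    (hcl : IsClosed X) (h0 : (0 : ℝ × ℝ) ∈ X) {p q : cantorSet × unitInterval}
    (hp : conePoint p ∈ X) (hq : conePoint q ∈ X) (hp0 : p.2 ≠ 0) (hq0 : q.2 ≠ 0)
    (hpq : p.1 ≠ q.1) : (0 : ℝ × ℝ) ∉ endpoints X := by
  intro h
  obtain ⟨c, t⟩ := p
  obtain ⟨d, s⟩ := q
  have ht : (t : ℝ) ≠ 0 := fun h => hp0 (Subtype.ext h)
  have hs : (s : ℝ) ≠ 0 := fun h => hq0 (Subtype.ext h)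
  have hcd : (d : ℝ) - c ≠ 0 := sub_ne_zero.2 fun h => hpq (Subtype.ext h.symm)
  let f : unitInterval → ℝ × ℝ := fun u =>
    max (1 - 2 * (u : ℝ)) 0 • conePoint (c, t) + max (2 * (u : ℝ) - 1) 0 • conePoint (d, s)
  have hf : IsEmbedding f := by
    refine (Continuous.isClosedEmbedding (by fun_prop) fun u v huv => ?_).isEmbedding
    have h1 := congrArg Prod.fst huv
    have h2 := congrArg Prod.snd huv
    simp only [f, conePoint, Prod.fst_add, Prod.snd_add, Prod.smul_fst, Prod.smul_snd,
      smul_eq_mul] at h1 h2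
    have h3 : (max (2 * (u : ℝ) - 1) 0 - max (2 * (v : ℝ) - 1) 0) * (s * (d - c)) = 0 := by
      linear_combination h1 - (c : ℝ) * h2
    have h4 := sub_eq_zero.1 ((mul_eq_zero.1 h3).resolve_right (mul_ne_zero hs hcd))
    rw [h4] at h2
    have h5 := mul_right_cancel₀ ht (add_right_cancel h2)
    have h6 : ∀ w : ℝ, max (1 - 2 * w) 0 - max (2 * w - 1) 0 = 1 - 2 * w := fun w => by
      rcases le_total (2 * w) 1 with hw | hw
      · rw [max_eq_left (by linarith), max_eq_right (by linarith)]; ring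
      · rw [max_eq_right (by linarith), max_eq_left (by linarith)]; ring
    refine Subtype.ext ?_
    linarith [h6 u, h6 v]
  have hfX : range f ⊆ X := by
    rintro _ ⟨u, rfl⟩
    have hu0 := u.2.1
    have hu1 := u.2.2
    rcases le_total (2 * (u : ℝ)) 1 with hu | hu
    · simp only [f]
      rw [max_eq_right (a := 2 * (u : ℝ) - 1) (by linarith), zero_smul, add_zero,
        max_eq_left (by linarith)]
      exact smul_mem_of_isPreconnected hX hc hcl h0 hp ⟨by linarith, by linarith⟩
    · simp only [f]
      rw [max_eq_right (a := 1 - 2 * (u : ℝ)) (by linarith), zero_smul, zero_add,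
        max_eq_left (by linarith)]
      exact smul_mem_of_isPreconnected hX hc hcl h0 hq ⟨by linarith, by linarith⟩
  obtain h | h := h.2 f hf hfX ⟨⟨1 / 2, by norm_num, by norm_num⟩, by norm_num [f]⟩
  · have := congrArg Prod.snd h
    norm_num [f, conePoint] at this
    exact ht this.symm
  · have := congrArg Prod.snd h
    norm_num [f, conePoint] at this
    exact hs this.symm

/-- A smooth fan inside one segment is a point or an arc, so it has at most two endpoints. -/
lemma finite_endpoints_of_subset_segment (hK : IsCompact X) (hc : IsConnected X) (c : ℝ)
    (hXc : ∀ z ∈ X, z.1 = z.2 * c) : (endpoints X).Finite := by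
  have hI : Prod.snd '' X = Icc (sInf (Prod.snd '' X)) (sSup (Prod.snd '' X)) :=
    eq_Icc_of_connected_compact (hc.image _ continuous_snd.continuousOn) (hK.image continuous_snd)
  set a := sInf (Prod.snd '' X)
  set b := sSup (Prod.snd '' X)
  have hmem : ∀ t ∈ Icc a b, (t * c, t) ∈ X := by
    intro t ht
    rw [← hI] at ht
    obtain ⟨z, hz, rfl⟩ := ht
    rwa [← hXc z hz]
  refine (toFinite {(a * c, a), (b * c, b)}).subset fun x hx => ?_
  obtain ⟨hax, hxb⟩ : x.2 ∈ Icc a b := hI ▸ mem_image_of_mem _ hx.1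
  have hx' : x = (x.2 * c, x.2) := Prod.ext (hXc x hx.1) rfl
  obtain hab | hab := (hax.trans hxb).eq_or_lt
  · left
    rw [hx', le_antisymm (hxb.trans hab.ge) hax]
  let h : unitInterval → ℝ := fun u => a + u * (b - a)
  have hf : IsEmbedding fun u : unitInterval => (h u * c, h u) := by
    refine (Continuous.isClosedEmbedding (by fun_prop) fun u v huv => ?_).isEmbedding
    have h2 : a + u * (b - a) = a + v * (b - a) := congrArg Prod.snd huv
    exact Subtype.ext (mul_right_cancel₀ (sub_pos.2 hab).ne' (add_left_cancel h2))
  obtain h1 | h1 := hx.2 _ hf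
    (by
      rintro _ ⟨u, rfl⟩
      have h1 := mul_nonneg u.2.1 (sub_pos.2 hab).le
      have h2 := mul_le_mul_of_nonneg_right u.2.2 (sub_pos.2 hab).le
      exact hmem _ ⟨by simp only [h]; linarith, by simp only [h]; linarith⟩)
    (by
      refine ⟨⟨(x.2 - a) / (b - a), unitInterval.div_mem (by linarith) (by linarith)
        (by linarith)⟩, ?_⟩
      have : h ⟨(x.2 - a) / (b - a), unitInterval.div_mem (by linarith) (by linarith)
          (by linarith)⟩ = x.2 := by
        simp only [h]
        rw [div_mul_cancel₀ _ (sub_pos.2 hab).ne']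
        ring
      simp only [this]
      exact hx'.symm)
  · left
    simpa [h] using h1
  · right
    simpa [h] using h1

end Connected

lemma hasSmallInductiveDimensionLE_zero_of_discrete {S : Type*} [TopologicalSpace S]
    [DiscreteTopology S] : HasSmallInductiveDimensionLE S 0 :=
  hasSmallInductiveDimensionLE_zero_iff.2 fun x _ hU =>
    ⟨{x}, isClopen_discrete _, rfl, singleton_subset_iff.2 (mem_of_mem_nhds hU)⟩

theorem dim_kernel_eq_dim_of_subset_endpoints {X : Set (ℝ × ℝ)} (hX : IsSmoothFan X)
    {Y : Set (ℝ × ℝ)} (hY : Y ⊆ endpoints X) : dim (kernel Y) = dim Y := by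
  obtain ⟨hXF, hK, hconn⟩ := hX
  have hc := hconn.isPreconnected
  have hcl := hK.isClosed
  by_cases hseg : ∃ c : ℝ, ∀ z ∈ X, z.1 = z.2 * c
  · obtain ⟨c, hXc⟩ := hseg
    have : Finite Y := (finite_endpoints_of_subset_segment hK hconn c hXc).subset hY
    have h0 : HasSmallInductiveDimensionLE Y 0 := hasSmallInductiveDimensionLE_zero_of_discrete
    exact dim_kernel_eq_dim (h0.mono zero_le_one)
      (HasSmallInductiveDimensionLE.mono zero_le_one hasSmallInductiveDimensionLE_zero_of_discrete)
      fun _ => h0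
  push Not at hseg
  -- `X` is not contained in one segment, so it contains points of two segments.
  have hcone0 : ∀ p : cantorSet × unitInterval, p.2 = 0 → conePoint p = 0 := by
    rintro ⟨c, t⟩ rfl
    exact conePoint_zero c
  have hne : ∀ c : cantorSet, ∃ q, conePoint q ∈ X ∧ q.2 ≠ 0 ∧ q.1 ≠ c := by
    intro c
    obtain ⟨z, hz, hzc⟩ := hseg c
    obtain ⟨q, rfl⟩ := hXF hz
    refine ⟨q, hz, fun h => hzc (by simp [hcone0 q h]), ?_⟩
    rintro rfl
    exact hzc rfl
  obtain ⟨p, hp, hp0, -⟩ := hne ⟨0, zero_mem_cantorSet⟩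
  obtain ⟨q, hq, hq0, hqp⟩ := hne p.1
  have h0 : (0 : ℝ × ℝ) ∈ X := zero_mem_of_fst_ne hXF hc hp hq hqp.symm
  have hvert := zero_notMem_endpoints hXF hc hcl h0 hp hq hp0 hq0 hqp.symm
  have hcoord : ∀ y : Y, ∃ p, conePoint p = y.1 := fun y => hXF (hY y.2).1
  choose g hg using hcoord
  have hg0 : ∀ y, (g y).2 ≠ 0 := fun y h => hvert (by
    rw [← hcone0 _ h, hg]
    exact hY y.2)
  have hg2 : ∀ y, ((g y).2 : ℝ) = y.1.2 := fun y => congrArg Prod.snd (hg y)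
  have hslope : ∀ p : cantorSet × unitInterval, p.2 ≠ 0 →
      (conePoint p).1 / (conePoint p).2 = p.1 := fun p hp =>
    mul_div_cancel_left₀ _ fun h => hp (Subtype.ext h)
  have hy0 : ∀ y : Y, y.1.2 ≠ 0 := fun y h => hg0 y (Subtype.ext ((hg2 y).trans h))
  have hπ : Continuous fun y => (g y).1 := by
    refine continuous_induced_rng.2 ?_
    have : (Subtype.val ∘ fun y => (g y).1) = fun y : Y => y.1.1 / y.1.2 := by
      ext y
      rw [← hg y, hslope _ (hg0 y)]
      rfl
    rw [this]
    exact (continuous_fst.comp continuous_subtype_val).div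
      (continuous_snd.comp continuous_subtype_val) hy0
  refine dim_kernel_eq_dim_of_isInducing (π := fun y => (g y).1) (φ := fun y : Y => y.1.2) ?_ ?_
  · refine IsInducing.of_comp (g := fun p : cantorSet × ℝ => (p.2 * (p.1 : ℝ), p.2))
      (by fun_prop) (by fun_prop) ?_
    convert (IsInducing.subtypeVal : IsInducing (Subtype.val : Y → ℝ × ℝ)) using 1
    ext y
    · simp only [Function.comp_apply]
      rw [← hg2, ← hg y]
      rfl
    · rfl
  · intro x δ hδ
    -- The slopes of the points of `X` of height at least `x.1.2 + δ` form a compact set, which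
    -- omits the slope of the endpoint `x`.
    have hxpos : (0 : ℝ) ≤ x.1.2 := hg2 x ▸ (g x).2.2.1
    let T : Set (ℝ × ℝ) := X ∩ {z | x.1.2 + δ ≤ z.2}
    have hT : IsCompact T := hK.inter_right (isClosed_le continuous_const continuous_snd)
    have hT0 : ∀ z ∈ T, z.2 ≠ 0 := fun z hz => by
      have : x.1.2 + δ ≤ z.2 := hz.2
      exact (by linarith : 0 < z.2).ne'
    have hslopeT : IsClosed ((fun z : ℝ × ℝ => z.1 / z.2) '' T) :=
      (hT.image_of_continuousOn (continuousOn_fst.div continuousOn_snd hT0)).isClosed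
    refine ⟨Subtype.val ⁻¹' ((fun z : ℝ × ℝ => z.1 / z.2) '' T)ᶜ,
      (hslopeT.isOpen_compl.preimage continuous_subtype_val).mem_nhds ?_, fun z hz => ?_⟩
    · rintro ⟨z, hz, hzx⟩
      obtain ⟨⟨c, t⟩, rfl⟩ := hXF hz.1
      have ht0 : t ≠ 0 := fun h => hT0 _ hz (by simp [conePoint, h])
      obtain rfl : c = (g x).1 := Subtype.ext ((hslope (c, t) ht0).symm.trans hzx)
      have hle : (t : ℝ) ≤ (g x).2 := le_of_conePoint_mem_endpoints hXF hc hcl h0 (hg0 x)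
        (show conePoint (g x) ∈ endpoints X from (hg x).symm ▸ hY x.2) hz.1
      have : x.1.2 + δ ≤ t := hz.2
      rw [hg2] at hle
      linarith
    · by_contra! hzδ
      refine hz ⟨z.1, ⟨(hY z.2).1, hzδ⟩, ?_⟩
      rw [← hslope _ (hg0 z), hg]

end SmoothFan

theorem corollary3 (X : Set (ℝ × ℝ)) (hX : SmoothFan.IsSmoothFan X) :
    (∀ Y : Set (ℝ × ℝ), Y ⊆ SmoothFan.endpoints X →
      SmoothFan.dim (SmoothFan.kernel Y) = SmoothFan.dim Y) ∧
    ¬ ∃ Y : Set (ℝ × ℝ), Y ⊆ SmoothFan.endpoints X ∧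
      SmoothFan.IsWeaklyOneDimensional Y := by
  have h : ∀ Y : Set (ℝ × ℝ), Y ⊆ SmoothFan.endpoints X →
      SmoothFan.dim (SmoothFan.kernel Y) = SmoothFan.dim Y :=
    fun Y hY => SmoothFan.dim_kernel_eq_dim_of_subset_endpoints hX hY
  refine ⟨h, ?_⟩
  rintro ⟨Y, hY, h1, h0⟩
  rw [h Y hY, h1] at h0
  exact one_ne_zero h0
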